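/- Notation. For $\psi:\mathbb R^n\to\mathbb R$ let $\psi^*(q)=\sup_{\xi\in\mathbb R^n}\langle q,\xi\rangle-\psi(\xi)$ be the convex conjugate, and let the perspective $\hat\psi:\mathbb R^n\times\mathbb R\to[-\infty,\infty]$ be $\hat\psi(v,r)=r\psi(v/r)$ for $r>0$, $\hat\psi(v,0)=\lim_{r\downarrow0}r\psi(v/r)$, and $\hat\psi(v,r)=+\infty$ for $r<0$. (For convex $\psi$ the limit exists in $[-\infty,\infty]$; a finite convex $\psi$ on $\mathbb R^n$ is continuous, hence closed.) Let $Z\in\mathbb R^{n\times d}$, and write $\|\cdot\|$ for the Euclidean norm. For an increasing bijection $\ell:\mathbb R\to(0,\infty)$ and $n\ge1$, the smoothed margin is $\psi_\ell(\xi)=\ell^{-1}\bigl(\sum_{i=1}^n\ell(\xi_i)\bigr)$. Theorem. (1) Let $n\ge1$, let $\ell:\mathbb R\to(0,\infty)$ be an increasing bijection, and suppose that $\psi=\psi_\ell$ is convex. Then the maximum and the minimum below exist, are finite, and $$\max_{\|w\|\le1,\ r\ge0}-\hat\psi(Zw,r)=\min_{q\in\mathbb R^n,\ \psi^*(q)\le0}\|Z^\top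 q\|.$$ (2) For an arbitrary convex $\psi:\mathbb R^n\to\mathbb R$ such that $\hat\psi(Zw,r)$ is bounded below over $\|w\|\le1$, $r\in\mathbb R$, $$\sup_{\|w\|\le1,\ r\ge0}-\hat\psi(Zw,r)=\min_{q\in\mathbb R^n,\ \psi^*(q)\le0}\|Z^\top q\|,$$ with a finite value; the minimum is attained, and the supremum is attained whenever $\psi(0)\ne0$. (3) Let $n\ge1$, $x_i\in\mathbb R^d$, $y_i\in\{-1,+1\}$ $(1\le i\le n)$ be linearly separable, i.e. $y_i\langle u,x_i\rangle>0$ for all $i$ and some $u\in\mathbb R^d$, and let $Z$ be the matrix with rows $z_i=-y_ix_i$. Let $\ell$ be as in (1), with $\psi=\psi_\ell$ convex, and exponentially tailed: for some $a>0$, $\ell(z)=\Theta(e^{az})$ as $z\to-\infty$. Then the maximum margin $\gamma=\max_{\|u\|=1}\min_{i}y_i\langle u,x_i\rangle$ exists, is positive, and $$\max_{\|w\|\le1,\ r\ge0}-\hat\psi(Zw,r)=\min_{q\in\mathbb R^n,\ \psi^*(q)\le0}\|Z^\top q\|=\gamma.$$ (4) The exponential loss $\ell(z)=e^z$ and the logistic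 loss $\ell(z)=\ln(1+e^z)$ satisfy all hypotheses on $\ell$ and $\psi_\ell$ in (1) and (3), for every $n\ge1$. -/

import Mathlib

open Filter Topology Matrix

noncomputable section

/-- The perspective `(v, r) ↦ r ψ(v / r)` of a finite function `ψ` on `ℝⁿ`, extended to `r = 0` by
the limit `r ↓ 0` and by `+∞` to `r < 0`. -/
def perspective {n : ℕ} (ψ : (Fin n → ℝ) → ℝ) (v : Fin n → ℝ) (r : ℝ) : EReal :=
  if 0 < r then ((r * ψ (r⁻¹ • v) : ℝ) : EReal)
  else if r = 0 then limUnder (𝓝[>] (0 : ℝ)) fun s : ℝ => ((s * ψ (s⁻¹ • v) : ℝ) : EReal)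
  else ⊤

/-- The limit in the definition of the perspective exists in `[-∞, ∞]` when `ψ` is convex. -/
theorem perspective_tendsto {n : ℕ} {ψ : (Fin n → ℝ) → ℝ} (hψ : ConvexOn ℝ Set.univ ψ)
    (v : Fin n → ℝ) :
    Tendsto (fun s : ℝ => ((s * ψ (s⁻¹ • v) : ℝ) : EReal)) (𝓝[>] (0 : ℝ))
      (𝓝 (perspective ψ v 0)) := by
  have hanti : AntitoneOn (fun s : ℝ => ((s * (ψ (s⁻¹ • v) - ψ 0) : ℝ) : EReal))
      (Set.Ioi 0) := by
    intro s hs t ht hst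
    have hs0 : (0 : ℝ) < s := hs
    have ht0 : (0 : ℝ) < t := ht
    have h := hψ.2 (Set.mem_univ (s⁻¹ • v)) (Set.mem_univ 0)
      (show 0 ≤ s / t by positivity)
      (show 0 ≤ 1 - s / t by rw [sub_nonneg, div_le_one ht0]; exact hst) (by ring)
    have e : (s / t) • s⁻¹ • v + (1 - s / t) • (0 : Fin n → ℝ) = t⁻¹ • v := by
      rw [smul_zero, add_zero, smul_smul]
      congr 1
      field_simp
    rw [e] at h
    simp only [smul_eq_mul] at h
    have h2 := mul_le_mul_of_nonneg_left h ht0.le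
    have e2 : t * (s / t * ψ (s⁻¹ • v) + (1 - s / t) * ψ 0)
        = s * ψ (s⁻¹ • v) + (t - s) * ψ 0 := by
      field_simp
    rw [e2] at h2
    exact EReal.coe_le_coe_iff.2 (by linarith)
  have h1 := hanti.tendsto_nhdsGT (OrderTop.bddAbove _)
  have h2 : Tendsto (fun s : ℝ => ((s * ψ 0 : ℝ) : EReal)) (𝓝[>] (0 : ℝ)) (𝓝 ((0 : ℝ) : EReal)) :=
    (continuous_coe_real_ereal.tendsto _).comp
      (((continuous_id.mul continuous_const).tendsto' 0 0 (by simp)).mono_left nhdsWithin_le_nhds)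
  have h3 := (EReal.continuousAt_add (by simp) (by simp)).tendsto.comp (h1.prodMk_nhds h2)
  have h4 : ∃ l, Tendsto (fun s : ℝ => ((s * ψ (s⁻¹ • v) : ℝ) : EReal)) (𝓝[>] (0 : ℝ)) (𝓝 l) := by
    refine ⟨_, h3.congr fun s => ?_⟩
    simp only [Function.comp]
    rw [← EReal.coe_add]
    congr 1
    ring
  have h5 : perspective ψ v 0
      = limUnder (𝓝[>] (0 : ℝ)) fun s : ℝ => ((s * ψ (s⁻¹ • v) : ℝ) : EReal) := by
    simp [perspective]
  rw [h5]
  exact tendsto_nhds_limUnder h4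

/-- The convex conjugate `ψ*(q) = sup_ξ ⟨q, ξ⟩ - ψ(ξ)`, with values in `[-∞, ∞]`. -/
def convexConjugate {n : ℕ} (ψ : (Fin n → ℝ) → ℝ) (q : Fin n → ℝ) : EReal :=
  ⨆ ξ : Fin n → ℝ, ((q ⬝ᵥ ξ - ψ ξ : ℝ) : EReal)

/-- The values of the primal objective `-ψ̂(Zw, r)` over `‖w‖₂ ≤ 1`, `r ≥ 0`. -/
def primalValues {n d : ℕ} (Z : Matrix (Fin n) (Fin d) ℝ) (ψ : (Fin n → ℝ) → ℝ) : Set EReal :=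
  {a | ∃ (w : EuclideanSpace ℝ (Fin d)) (r : ℝ),
    ‖w‖ ≤ 1 ∧ 0 ≤ r ∧ a = -perspective ψ (Z *ᵥ w.ofLp) r}

/-- The values of the dual objective `‖Zᵀq‖₂` over the `q` with `ψ*(q) ≤ 0`. -/
def dualValues {n d : ℕ} (Z : Matrix (Fin n) (Fin d) ℝ) (ψ : (Fin n → ℝ) → ℝ) : Set ℝ :=
  {a | ∃ q : Fin n → ℝ, convexConjugate ψ q ≤ 0 ∧ a = ‖WithLp.toLp 2 (Zᵀ *ᵥ q)‖}

/-- `ℓ` is an increasing bijection from `ℝ` onto `(0, ∞)`, so that `ℓ⁻¹ : (0, ∞) → ℝ` exists. -/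
structure IsIncreasingLoss (ℓ : ℝ → ℝ) : Prop where
  strictMono : StrictMono ℓ
  range_eq : Set.range ℓ = Set.Ioi 0

/-- The generalized sum (smoothed margin) `ψ(ξ) = ℓ⁻¹(∑ᵢ ℓ(ξᵢ))`. -/
def generalizedSum (ℓ : ℝ → ℝ) (n : ℕ) (ξ : Fin n → ℝ) : ℝ :=
  Function.invFun ℓ (∑ i, ℓ (ξ i))

/-- `ℓ(z)` is of the exact order of `exp(a z)` as `z → -∞`, for some `a > 0`. -/
def HasExponentialTail (ℓ : ℝ → ℝ) : Prop :=
  ∃ a : ℝ, 0 < a ∧ ℓ =Θ[atBot] fun z => Real.exp (a * z)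

/-- The exponential loss. -/
def expLoss (z : ℝ) : ℝ := Real.exp z

/-- The logistic loss. -/
def logisticLoss (z : ℝ) : ℝ := Real.log (1 + Real.exp z)

/-- The matrix whose rows are `zᵢ = -yᵢ xᵢ`. -/
def dataMatrix {n d : ℕ} (x : Fin n → EuclideanSpace ℝ (Fin d)) (y : Fin n → ℝ) :
    Matrix (Fin n) (Fin d) ℝ :=
  Matrix.of fun i j => -(y i * x i j)

/-- The margins `minᵢ yᵢ⟨u, xᵢ⟩` of the unit vectors `u`. -/
def unitMargins {n d : ℕ} (x : Fin n → EuclideanSpace ℝ (Fin d)) (y : Fin n → ℝ) : Set ℝ :=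
  {m | ∃ u : EuclideanSpace ℝ (Fin d), ‖u‖ = 1 ∧ m = ⨅ i, y i * inner ℝ u (x i)}

end

/-! The constraint `ψ*(q) ≤ 0` says that the linear form `q` lies below `ψ`. If `ψ 0 ≥ 0`, then
`p(v) = inf_{r>0} r ψ(v/r)` is finite and sublinear, and by Hahn–Banach it is the support function
of the compact set `C` of these minorants (`exists_minorant_eq_infPerspective`). The duality is then
a projection: if `P` is the point of `Zᵀ C` nearest to the origin, Cauchy–Schwarz bounds every
primal value by `‖P‖`, and the variational inequality at `P` gives `p(Zw) ≤ -‖P‖` for `w = -P/‖P‖`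
(`exists_isLeast_dualValues`).

The primal maximum is attained when the infimum over `r` is: for `ψ 0 > 0` by coercivity in `r`
(`exists_perspective_le`), and for a smoothed margin with `n = 1` because `r ψ(v/r)` is constant.

A smoothed margin dominates every coordinate, hence so does its perspective. An exponential tail
makes the perspective at `r = 0` at most `max vᵢ` when all `vᵢ` are negative. So a maximum margin
direction with `r = 0` is primal optimal, with value `γ`. -/

/-! ### The perspective, its infimum over the scale, and linear minorants. -/

section Perspective

variable {n : ℕ} {ψ : (Fin n → ℝ) → ℝ}

theorem perspective_of_pos (ψ : (Fin n → ℝ) → ℝ) (v : Fin n → ℝ) {r : ℝ} (hr : 0 < r) :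
    perspective ψ v r = ((r * ψ (r⁻¹ • v) : ℝ) : EReal) := by
  simp [perspective, hr]

theorem perspective_of_neg (ψ : (Fin n → ℝ) → ℝ) (v : Fin n → ℝ) {r : ℝ} (hr : r < 0) :
    perspective ψ v r = ⊤ := by
  simp [perspective, hr.ne, hr.not_gt]

theorem le_perspective_of_forall_pos (hψ : ConvexOn ℝ Set.univ ψ) {v : Fin n → ℝ} {c : ℝ}
    (h : ∀ s : ℝ, 0 < s → c ≤ s * ψ (s⁻¹ • v)) (r : ℝ) : (c : EReal) ≤ perspective ψ v r := by
  rcases lt_trichotomy r 0 with hr | rfl | hr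
  · simp [perspective_of_neg ψ v hr]
  · refine ge_of_tendsto (perspective_tendsto hψ v) ?_
    filter_upwards [self_mem_nhdsWithin] with s hs
    exact EReal.coe_le_coe_iff.2 (h s hs)
  · rw [perspective_of_pos ψ v hr]
    exact EReal.coe_le_coe_iff.2 (h r hr)

theorem convexConjugate_nonpos_iff {q : Fin n → ℝ} :
    convexConjugate ψ q ≤ 0 ↔ ∀ ξ, q ⬝ᵥ ξ ≤ ψ ξ := by
  simp only [convexConjugate, iSup_le_iff, ← EReal.coe_zero, EReal.coe_le_coe_iff, sub_nonpos]

theorem dotProduct_le_mul_of_minorant {q : Fin n → ℝ} (hq : ∀ ξ, q ⬝ᵥ ξ ≤ ψ ξ) (v : Fin n → ℝ)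
    {s : ℝ} (hs : 0 < s) : q ⬝ᵥ v ≤ s * ψ (s⁻¹ • v) := by
  have h := mul_le_mul_of_nonneg_left (hq (s⁻¹ • v)) hs.le
  rwa [dotProduct_smul, smul_eq_mul, mul_inv_cancel_left₀ hs.ne'] at h

/-- The infimum of the perspective over `r > 0`. -/
noncomputable def infPerspective (ψ : (Fin n → ℝ) → ℝ) (v : Fin n → ℝ) : ℝ :=
  ⨅ r : Set.Ioi (0 : ℝ), (r : ℝ) * ψ ((r : ℝ)⁻¹ • v)

/-- The origin is a convex combination of `v / r` and `-v`. The bound does not depend on `r`, so the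
real infimum `infPerspective` is a genuine one and not a default value. -/
theorem neg_le_mul_of_convexOn (hψ : ConvexOn ℝ Set.univ ψ) (h0 : 0 ≤ ψ 0) (v : Fin n → ℝ)
    {r : ℝ} (hr : 0 < r) : -ψ (-v) ≤ r * ψ (r⁻¹ • v) := by
  have h := hψ.2 (Set.mem_univ (r⁻¹ • v)) (Set.mem_univ (-v))
    (show 0 ≤ r / (1 + r) by positivity) (show 0 ≤ 1 / (1 + r) by positivity) (by field_simp; ring)
  have e : (r / (1 + r)) • r⁻¹ • v + (1 / (1 + r)) • (-v) = 0 := by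
    rw [smul_smul, smul_neg, ← sub_eq_add_neg, ← sub_smul]
    have : r / (1 + r) * r⁻¹ - 1 / (1 + r) = 0 := by field_simp; ring
    rw [this, zero_smul]
  rw [e, smul_eq_mul, smul_eq_mul] at h
  have h2 := mul_nonneg (show 0 ≤ 1 + r by positivity) (h0.trans h)
  have e2 : (1 + r) * (r / (1 + r) * ψ (r⁻¹ • v) + 1 / (1 + r) * ψ (-v))
      = r * ψ (r⁻¹ • v) + ψ (-v) := by field_simp
  linarith

theorem infPerspective_le (hψ : ConvexOn ℝ Set.univ ψ) (h0 : 0 ≤ ψ 0) (v : Fin n → ℝ)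
    {r : ℝ} (hr : 0 < r) : infPerspective ψ v ≤ r * ψ (r⁻¹ • v) := by
  refine ciInf_le (f := fun r : Set.Ioi (0 : ℝ) => (r : ℝ) * ψ ((r : ℝ)⁻¹ • v)) ?_ ⟨r, hr⟩
  refine ⟨-ψ (-v), ?_⟩
  rintro _ ⟨s, rfl⟩
  exact neg_le_mul_of_convexOn hψ h0 v s.2

theorem le_infPerspective {v : Fin n → ℝ} {c : ℝ}
    (h : ∀ r : ℝ, 0 < r → c ≤ r * ψ (r⁻¹ • v)) : c ≤ infPerspective ψ v :=
  have : Nonempty (Set.Ioi (0 : ℝ)) := ⟨⟨1, Set.mem_Ioi.2 one_pos⟩⟩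
  le_ciInf fun r => h r r.2

theorem infPerspective_smul_le (hψ : ConvexOn ℝ Set.univ ψ) (h0 : 0 ≤ ψ 0) {c : ℝ} (hc : 0 < c)
    (v : Fin n → ℝ) : c * infPerspective ψ v ≤ infPerspective ψ (c • v) := by
  refine le_infPerspective fun r hr => ?_
  have h := infPerspective_le hψ h0 v (div_pos hr hc)
  have e : (r / c)⁻¹ • v = r⁻¹ • c • v := by
    rw [smul_smul, inv_div, div_eq_inv_mul]
  rw [e] at h
  calc c * infPerspective ψ v ≤ c * (r / c * ψ (r⁻¹ • c • v)) := by gcongr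
    _ = r * ψ (r⁻¹ • c • v) := by field_simp

theorem infPerspective_smul (hψ : ConvexOn ℝ Set.univ ψ) (h0 : 0 ≤ ψ 0) {c : ℝ} (hc : 0 < c)
    (v : Fin n → ℝ) : infPerspective ψ (c • v) = c * infPerspective ψ v := by
  refine le_antisymm ?_ (infPerspective_smul_le hψ h0 hc v)
  have h := infPerspective_smul_le hψ h0 (inv_pos.2 hc) (c • v)
  rw [inv_smul_smul₀ hc.ne'] at h
  rwa [inv_mul_le_iff₀ hc] at h

/-- `(v + w)/(r + s)` is the average of `v/r` and `w/s` with weights proportional to `r` and `s`;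
the infima over `r` and `s` are then taken one at a time. -/
theorem infPerspective_add_le (hψ : ConvexOn ℝ Set.univ ψ) (h0 : 0 ≤ ψ 0) (v w : Fin n → ℝ) :
    infPerspective ψ (v + w) ≤ infPerspective ψ v + infPerspective ψ w := by
  have key : ∀ r s : ℝ, 0 < r → 0 < s →
      infPerspective ψ (v + w) ≤ r * ψ (r⁻¹ • v) + s * ψ (s⁻¹ • w) := by
    intro r s hr hs
    refine (infPerspective_le hψ h0 (v + w) (add_pos hr hs)).trans ?_
    have h := hψ.2 (Set.mem_univ (r⁻¹ • v)) (Set.mem_univ (s⁻¹ • w))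
      (show 0 ≤ r / (r + s) by positivity) (show 0 ≤ s / (r + s) by positivity)
      (by field_simp)
    have e : (r / (r + s)) • r⁻¹ • v + (s / (r + s)) • s⁻¹ • w = (r + s)⁻¹ • (v + w) := by
      rw [smul_smul, smul_smul, smul_add]
      congr 2 <;> field_simp
    rw [e, smul_eq_mul, smul_eq_mul] at h
    calc (r + s) * ψ ((r + s)⁻¹ • (v + w))
        ≤ (r + s) * (r / (r + s) * ψ (r⁻¹ • v) + s / (r + s) * ψ (s⁻¹ • w)) := by gcongr
      _ = _ := by field_simp
  have h1 : ∀ s : ℝ, 0 < s →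
      infPerspective ψ (v + w) - s * ψ (s⁻¹ • w) ≤ infPerspective ψ v := fun s hs =>
    le_infPerspective fun r hr => by linarith [key r s hr hs]
  have h2 : infPerspective ψ (v + w) - infPerspective ψ v ≤ infPerspective ψ w :=
    le_infPerspective fun s hs => by linarith [h1 s hs]
  linarith

/-- Hahn–Banach: the functional `c • v ↦ c p(v)` on the line through `v` extends to a linear form
below `p`, and `p ≤ ψ` by taking `r = 1`. -/
theorem exists_minorant_eq_infPerspective (hψ : ConvexOn ℝ Set.univ ψ) (h0 : 0 ≤ ψ 0)
    (v : Fin n → ℝ) :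
    ∃ q : Fin n → ℝ, (∀ ξ, q ⬝ᵥ ξ ≤ ψ ξ) ∧ infPerspective ψ v ≤ q ⬝ᵥ v := by
  have hzero : infPerspective ψ 0 = 0 := by
    have h := infPerspective_smul hψ h0 two_pos 0
    rw [smul_zero] at h
    linarith
  have hspan : ∀ c : ℝ, c * infPerspective ψ v ≤ infPerspective ψ (c • v) := by
    intro c
    rcases lt_trichotomy c 0 with hc | rfl | hc
    -- Negative multiples: `0 = p(0) ≤ p(cv) + p(-cv)`.
    · have h1 := infPerspective_add_le hψ h0 (c • v) ((-c) • v)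
      rw [← add_smul, add_neg_cancel, zero_smul, hzero,
        infPerspective_smul hψ h0 (neg_pos.2 hc)] at h1
      linarith
    · simp [hzero]
    · exact (infPerspective_smul hψ h0 hc v).ge
  obtain ⟨g, hg, hgv⟩ : ∃ g : (Fin n → ℝ) →ₗ[ℝ] ℝ,
      (∀ x, g x ≤ infPerspective ψ x) ∧ g v = infPerspective ψ v := by
    by_cases hv : v = 0
    · obtain ⟨g, -, hg⟩ := exists_extension_of_le_sublinear (⊥ : (Fin n → ℝ) →ₗ.[ℝ] ℝ)
        (infPerspective ψ) (fun c hc x => infPerspective_smul hψ h0 hc x)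
        (infPerspective_add_le hψ h0) (by
          rintro ⟨x, hx⟩
          have hx0 : x = 0 := (Submodule.mem_bot ℝ).1 hx
          subst hx0
          rw [hzero]
          exact (LinearPMap.map_zero _).le)
      exact ⟨g, hg, by simp [hv, hzero]⟩
    · obtain ⟨g, hg', hg⟩ := exists_extension_of_le_sublinear
        (LinearPMap.mkSpanSingleton (K := ℝ) v (infPerspective ψ v) hv)
        (infPerspective ψ) (fun c hc x => infPerspective_smul hψ h0 hc x)
        (infPerspective_add_le hψ h0) (by
          rintro ⟨x, hx⟩
          obtain ⟨c, rfl⟩ := Submodule.mem_span_singleton.1 hx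
          refine le_of_eq_of_le ?_ (hspan c)
          exact LinearPMap.mkSpanSingleton'_apply v _ _ c hx)
      refine ⟨g, hg, ?_⟩
      have h := hg' ⟨v, Submodule.mem_span_singleton_self v⟩
      exact h.trans (LinearPMap.mkSpanSingleton_apply ℝ ℝ hv _)
  have hdot : ∀ x, (fun i => g (Pi.single i 1)) ⬝ᵥ x = g x := by
    intro x
    conv_rhs => rw [← Finset.univ_sum_single x, map_sum]
    refine Finset.sum_congr rfl fun i _ => ?_
    have : Pi.single i (x i) = x i • (Pi.single i 1 : Fin n → ℝ) := by
      rw [← Pi.single_smul, smul_eq_mul, mul_one]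
    rw [this, map_smul, smul_eq_mul, mul_comm]
  refine ⟨fun i => g (Pi.single i 1), fun ξ => ?_, ?_⟩
  · rw [hdot]
    refine (hg ξ).trans ?_
    simpa using infPerspective_le hψ h0 ξ one_pos
  · rw [hdot, hgv]

end Perspective

/-! ### Duality by projection, and attainment of the primal supremum. -/

section Duality

variable {n d : ℕ} {ψ : (Fin n → ℝ) → ℝ}

/-- Testing a minorant on `± eᵢ` confines it to a box. -/
theorem isCompact_setOf_minorant (ψ : (Fin n → ℝ) → ℝ) :
    IsCompact {q : Fin n → ℝ | ∀ ξ, q ⬝ᵥ ξ ≤ ψ ξ} := by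
  refine IsCompact.of_isClosed_subset
    (isCompact_Icc (a := fun i => -ψ (-Pi.single i 1)) (b := fun i => ψ (Pi.single i 1))) ?_ ?_
  · simp only [Set.ofPred_forall]
    exact isClosed_iInter fun ξ => isClosed_le (by unfold dotProduct; fun_prop) continuous_const
  · intro q hq
    refine ⟨fun i => ?_, fun i => ?_⟩
    · have h := hq (-Pi.single i 1)
      rw [dotProduct_neg, dotProduct_single_one] at h
      exact neg_le.1 h
    · simpa using hq (Pi.single i 1)

theorem inner_toLp_transpose_mulVec (Z : Matrix (Fin n) (Fin d) ℝ) (q : Fin n → ℝ)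
    (w : EuclideanSpace ℝ (Fin d)) :
    inner ℝ (WithLp.toLp 2 (Zᵀ *ᵥ q)) w = q ⬝ᵥ (Z *ᵥ w.ofLp) := by
  rw [EuclideanSpace.inner_eq_star_dotProduct, star_trivial, mulVec_transpose, dotProduct_comm,
    dotProduct_mulVec]

theorem neg_norm_le_dotProduct_mulVec (Z : Matrix (Fin n) (Fin d) ℝ) (q : Fin n → ℝ)
    {w : EuclideanSpace ℝ (Fin d)} (hw : ‖w‖ ≤ 1) :
    -‖WithLp.toLp 2 (Zᵀ *ᵥ q)‖ ≤ q ⬝ᵥ (Z *ᵥ w.ofLp) := by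
  rw [← inner_toLp_transpose_mulVec, neg_le]
  calc _ ≤ |inner ℝ (WithLp.toLp 2 (Zᵀ *ᵥ q)) w| := neg_le_abs _
    _ ≤ ‖WithLp.toLp 2 (Zᵀ *ᵥ q)‖ * ‖w‖ := abs_real_inner_le_norm _ _
    _ ≤ _ := mul_le_of_le_one_right (norm_nonneg _) hw

/-- Duality, with the primal problem in terms of the infimum of the perspective. -/
theorem exists_isLeast_dualValues (hψ : ConvexOn ℝ Set.univ ψ) (h0 : 0 ≤ ψ 0)
    (Z : Matrix (Fin n) (Fin d) ℝ) :
    ∃ m : ℝ, IsLeast (dualValues Z ψ) m ∧ (m : EReal) ∈ upperBounds (primalValues Z ψ) ∧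
      ∃ w : EuclideanSpace ℝ (Fin d), ‖w‖ ≤ 1 ∧ infPerspective ψ (Z *ᵥ w.ofLp) ≤ -m := by
  obtain ⟨q, hq, -⟩ := exists_minorant_eq_infPerspective hψ h0 0
  obtain ⟨p, hp, hmin⟩ := (isCompact_setOf_minorant ψ).exists_isMinOn ⟨q, hq⟩
    (f := fun q => ‖WithLp.toLp 2 (Zᵀ *ᵥ q)‖)
    (Continuous.continuousOn (by fun_prop))
  refine ⟨‖WithLp.toLp 2 (Zᵀ *ᵥ p)‖, ⟨⟨p, convexConjugate_nonpos_iff.2 hp, rfl⟩, ?_⟩, ?_, ?_⟩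
  · rintro _ ⟨q, hq, rfl⟩
    exact hmin (convexConjugate_nonpos_iff.1 hq)
  · rintro _ ⟨w, r, hw, -, rfl⟩
    rw [EReal.neg_le, ← EReal.coe_neg]
    exact le_perspective_of_forall_pos hψ (fun s hs =>
      (neg_norm_le_dotProduct_mulVec Z p hw).trans (dotProduct_le_mul_of_minorant hp _ hs)) r
  · set P : EuclideanSpace ℝ (Fin d) := WithLp.toLp 2 (Zᵀ *ᵥ p) with hP
    -- Variational inequality for the projection `P` of the origin onto the convex image `K`.
    have hproj : ∀ q : Fin n → ℝ, (∀ ξ, q ⬝ᵥ ξ ≤ ψ ξ) →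
        ‖P‖ ^ 2 ≤ inner ℝ (WithLp.toLp 2 (Zᵀ *ᵥ q)) P := by
      intro q hq
      let K : Set (EuclideanSpace ℝ (Fin d)) :=
        (fun q => WithLp.toLp 2 (Zᵀ *ᵥ q)) '' {q : Fin n → ℝ | ∀ ξ, q ⬝ᵥ ξ ≤ ψ ξ}
      have hK : Convex ℝ K := by
        rintro _ ⟨a, ha, rfl⟩ _ ⟨b, hb, rfl⟩ s t hs ht hst
        refine ⟨s • a + t • b, fun ξ => ?_, ?_⟩
        · rw [add_dotProduct, smul_dotProduct, smul_dotProduct, smul_eq_mul, smul_eq_mul]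
          calc s * (a ⬝ᵥ ξ) + t * (b ⬝ᵥ ξ) ≤ s * ψ ξ + t * ψ ξ := by
                gcongr
                exacts [ha ξ, hb ξ]
            _ = ψ ξ := by rw [← add_mul, hst, one_mul]
        · simp [mulVec_add, mulVec_smul]
      have hPK : P ∈ K := ⟨p, hp, rfl⟩
      have : Nonempty K := ⟨⟨P, hPK⟩⟩
      have h := (norm_eq_iInf_iff_real_inner_le_zero hK (u := 0) hPK).1 (by
        refine le_antisymm (le_ciInf ?_) (ciInf_le ⟨0, ?_⟩ (⟨P, hPK⟩ : K))
        · rintro ⟨_, a, ha, rfl⟩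
          simpa using hmin ha
        · rintro _ ⟨a, rfl⟩
          exact norm_nonneg _) _ ⟨q, hq, rfl⟩
      rw [zero_sub, inner_neg_left, inner_sub_right, real_inner_self_eq_norm_sq,
        real_inner_comm] at h
      linarith
    -- If `P = 0`, this is `w = 0`, which is still feasible.
    refine ⟨-(‖P‖⁻¹ • P), ?_, ?_⟩
    · rw [norm_neg, norm_smul, norm_inv, norm_norm]
      exact inv_mul_le_one
    · obtain ⟨q, hq, hle⟩ :=
        exists_minorant_eq_infPerspective hψ h0 (Z *ᵥ (-(‖P‖⁻¹ • P)).ofLp)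
      refine hle.trans ?_
      rw [← inner_toLp_transpose_mulVec, inner_neg_right, inner_smul_right, neg_le_neg_iff]
      rcases eq_or_ne ‖P‖ 0 with h | h
      · simp [h]
      · rw [← div_eq_inv_mul, le_div_iff₀ (lt_of_le_of_ne (norm_nonneg _) h.symm), ← sq]
        exact hproj q hq

theorem isLUB_primalValues {Z : Matrix (Fin n) (Fin d) ℝ} {m : ℝ}
    (hm : (m : EReal) ∈ upperBounds (primalValues Z ψ)) {w : EuclideanSpace ℝ (Fin d)}
    (hw : ‖w‖ ≤ 1) (h : infPerspective ψ (Z *ᵥ w.ofLp) ≤ -m) :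
    IsLUB (primalValues Z ψ) (m : EReal) := by
  refine ⟨hm, fun b hb => EReal.le_of_forall_lt_iff_le.1 fun z hz => ?_⟩
  have hz' : -z ≤ infPerspective ψ (Z *ᵥ w.ofLp) := le_infPerspective fun r hr => by
    have h1 : -perspective ψ (Z *ᵥ w.ofLp) r ≤ b := hb ⟨w, r, hw, hr.le, rfl⟩
    have h2 := h1.trans hz.le
    rw [perspective_of_pos _ _ hr, ← EReal.coe_neg, EReal.coe_le_coe_iff] at h2
    linarith
  exact EReal.coe_le_coe_iff.2 (by linarith)

theorem mem_primalValues {Z : Matrix (Fin n) (Fin d) ℝ} {m : ℝ}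
    (hm : (m : EReal) ∈ upperBounds (primalValues Z ψ)) {w : EuclideanSpace ℝ (Fin d)}
    (hw : ‖w‖ ≤ 1) (h : infPerspective ψ (Z *ᵥ w.ofLp) ≤ -m) {r : ℝ} (hr : 0 ≤ r)
    (hmin : ∀ s : ℝ, 0 < s →
      perspective ψ (Z *ᵥ w.ofLp) r ≤ ((s * ψ (s⁻¹ • Z *ᵥ w.ofLp) : ℝ) : EReal)) :
    (m : EReal) ∈ primalValues Z ψ := by
  refine ⟨w, r, hw, hr, le_antisymm ?_ (hm ⟨w, r, hw, hr, rfl⟩)⟩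
  rw [EReal.le_neg, ← EReal.coe_neg]
  generalize perspective ψ (Z *ᵥ w.ofLp) r = t at hmin
  induction t using EReal.rec with
  | bot => exact bot_le
  | top => exact absurd (hmin 1 one_pos) (by simp)
  | coe x =>
    exact EReal.coe_le_coe_iff.2 ((le_infPerspective fun s hs =>
      EReal.coe_le_coe_iff.1 (hmin s hs)).trans h)

/-- As `s → ∞`, `s ψ(v/s)` grows like `s ψ(0)`, so a minimizer can be sought on a compact interval.
There the perspective is continuous into `EReal`, at `0` by its definition as a limit. -/
theorem exists_perspective_le (hψ : ConvexOn ℝ Set.univ ψ) (h0 : 0 < ψ 0) (v : Fin n → ℝ) :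
    ∃ r : ℝ, 0 ≤ r ∧
      ∀ s : ℝ, 0 < s → perspective ψ v r ≤ ((s * ψ (s⁻¹ • v) : ℝ) : EReal) := by
  have hcont : Continuous ψ := continuousOn_univ.1 (hψ.continuousOn isOpen_univ)
  have hlim : Tendsto (fun s : ℝ => s * ψ (s⁻¹ • v)) atTop atTop := by
    refine tendsto_id.atTop_mul_pos h0 (hcont.tendsto' 0 _ rfl |>.comp ?_)
    simpa using (tendsto_inv_atTop_zero (𝕜 := ℝ)).smul_const v
  obtain ⟨R, hR⟩ := eventually_atTop.1 (hlim.eventually_ge_atTop (ψ v))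
  have hpc : ContinuousOn (perspective ψ v) (Set.Icc 0 (max R 1)) := by
    intro r hr
    rcases hr.1.eq_or_lt with rfl | hr0
    · have h1 : ContinuousWithinAt (perspective ψ v) (Set.Ioi 0) 0 := by
        refine (perspective_tendsto hψ v).congr' ?_
        filter_upwards [self_mem_nhdsWithin] with s hs
        exact (perspective_of_pos ψ v hs).symm
      exact (continuousWithinAt_Ioi_iff_Ici.1 h1).mono Set.Icc_subset_Ici_self
    · have h1 : ContinuousAt (fun s : ℝ => ((s * ψ (s⁻¹ • v) : ℝ) : EReal)) r := by
        refine continuous_coe_real_ereal.continuousAt.comp ?_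
        refine continuousAt_id.mul (hcont.continuousAt.comp ?_)
        exact (continuousAt_inv₀ hr0.ne').smul continuousAt_const
      refine (h1.congr ?_).continuousWithinAt
      filter_upwards [Ioi_mem_nhds hr0] with s hs
      exact (perspective_of_pos ψ v hs).symm
  -- The endpoint is at least `1` so that the reference value `ψ v`, taken at scale `1`, is among
  -- those compared; beyond `R` all values are at least `ψ v`.
  obtain ⟨r, hr, hmin⟩ := isCompact_Icc.exists_isMinOn
    (Set.nonempty_Icc.2 (zero_le_one.trans (le_max_right R 1))) hpc
  refine ⟨r, hr.1, fun s hs => ?_⟩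
  rcases le_total s (max R 1) with h | h
  · rw [← perspective_of_pos ψ v hs]
    exact hmin ⟨hs.le, h⟩
  · have h1 : perspective ψ v r ≤ perspective ψ v 1 := hmin ⟨zero_le_one, le_max_right R 1⟩
    rw [perspective_of_pos ψ v one_pos] at h1
    refine h1.trans (EReal.coe_le_coe_iff.2 ?_)
    simpa using hR s ((le_max_left R 1).trans h)

theorem primal_dual_of_bounded (hψ : ConvexOn ℝ Set.univ ψ) (Z : Matrix (Fin n) (Fin d) ℝ)
    (hB : ∃ B : ℝ, ∀ w : EuclideanSpace ℝ (Fin d), ‖w‖ ≤ 1 → ∀ r : ℝ,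
      (B : EReal) ≤ perspective ψ (Z *ᵥ w.ofLp) r) :
    ∃ m : ℝ, IsLUB (primalValues Z ψ) (m : EReal) ∧ IsLeast (dualValues Z ψ) m ∧
      (ψ 0 ≠ 0 → (m : EReal) ∈ primalValues Z ψ) := by
  obtain ⟨B, hB⟩ := hB
  have h0 : 0 ≤ ψ 0 := by
    by_contra! hneg
    -- At `w = 0` the perspective is `r ψ(0)`; this `r` gives `-(|B| + 1) < B`.
    have hr : 0 < (|B| + 1) / -ψ 0 := div_pos (by positivity) (neg_pos.2 hneg)
    have h := hB 0 (by simp) ((|B| + 1) / -ψ 0)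
    rw [perspective_of_pos _ _ hr, EReal.coe_le_coe_iff] at h
    simp only [WithLp.ofLp_zero, mulVec_zero, smul_zero] at h
    have e : (|B| + 1) / -ψ 0 * ψ 0 = -(|B| + 1) := by
      have := hneg.ne
      field_simp
    linarith [neg_abs_le B]
  obtain ⟨m, hleast, hub, w, hw, hle⟩ := exists_isLeast_dualValues hψ h0 Z
  refine ⟨m, isLUB_primalValues hub hw hle, hleast, fun hne => ?_⟩
  obtain ⟨r, hr, hmin⟩ := exists_perspective_le hψ (lt_of_le_of_ne h0 hne.symm) (Z *ᵥ w.ofLp)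
  exact mem_primalValues hub hw hle hr hmin

end Duality

/-! ### Smoothed margins and the effect of an exponential tail. -/

section Loss

variable {n : ℕ} {ℓ : ℝ → ℝ}

theorem IsIncreasingLoss.pos (hℓ : IsIncreasingLoss ℓ) (z : ℝ) : 0 < ℓ z := by
  have h : ℓ z ∈ Set.range ℓ := ⟨z, rfl⟩
  rwa [hℓ.range_eq] at h

theorem IsIncreasingLoss.apply_generalizedSum (hℓ : IsIncreasingLoss ℓ) (hn : 0 < n)
    (ξ : Fin n → ℝ) : ℓ (generalizedSum ℓ n ξ) = ∑ i, ℓ (ξ i) := by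
  have : Nonempty (Fin n) := ⟨⟨0, hn⟩⟩
  have h : ∑ i, ℓ (ξ i) ∈ Set.range ℓ := by
    rw [hℓ.range_eq]
    exact Finset.sum_pos (fun i _ => hℓ.pos _) Finset.univ_nonempty
  exact Function.invFun_eq h

theorem IsIncreasingLoss.le_generalizedSum (hℓ : IsIncreasingLoss ℓ) (ξ : Fin n → ℝ) (i : Fin n) :
    ξ i ≤ generalizedSum ℓ n ξ := by
  rw [← hℓ.strictMono.le_iff_le, hℓ.apply_generalizedSum i.pos]
  exact Finset.single_le_sum (f := fun i => ℓ (ξ i)) (fun j _ => (hℓ.pos _).le) (Finset.mem_univ i)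

theorem IsIncreasingLoss.generalizedSum_one (hℓ : IsIncreasingLoss ℓ) (ξ : Fin 1 → ℝ) :
    generalizedSum ℓ 1 ξ = ξ 0 := by
  apply hℓ.strictMono.injective
  simp [hℓ.apply_generalizedSum one_pos]

theorem IsIncreasingLoss.generalizedSum_zero_pos (hℓ : IsIncreasingLoss ℓ) (hn : 1 < n) :
    0 < generalizedSum ℓ n 0 := by
  rw [← hℓ.strictMono.lt_iff_lt, hℓ.apply_generalizedSum (zero_lt_one.trans hn)]
  have h1 : (1 : ℝ) < n := by exact_mod_cast hn
  simpa using lt_mul_of_one_lt_left (hℓ.pos 0) h1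

theorem IsIncreasingLoss.primal_dual {d : ℕ} (hℓ : IsIncreasingLoss ℓ) (hn : 0 < n)
    (hψ : ConvexOn ℝ Set.univ (generalizedSum ℓ n)) (Z : Matrix (Fin n) (Fin d) ℝ) :
    ∃ m : ℝ, IsGreatest (primalValues Z (generalizedSum ℓ n)) (m : EReal) ∧
      IsLeast (dualValues Z (generalizedSum ℓ n)) m := by
  obtain ⟨m, hleast, hub, w, hw, hle⟩ := exists_isLeast_dualValues hψ
    (by simpa using hℓ.le_generalizedSum 0 ⟨0, hn⟩) Z
  obtain ⟨r, hr, hmin⟩ : ∃ r : ℝ, 0 ≤ r ∧ ∀ s : ℝ, 0 < s →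
      perspective (generalizedSum ℓ n) (Z *ᵥ w.ofLp) r ≤
        ((s * generalizedSum ℓ n (s⁻¹ • Z *ᵥ w.ofLp) : ℝ) : EReal) := by
    -- For `n = 1` the value `ψ 0` is zero and coercivity fails, but `ψ` is the identity, so every
    -- `r > 0` is a minimizer.
    rcases (Nat.succ_le_of_lt hn).eq_or_lt with rfl | h1
    · refine ⟨1, zero_le_one, fun s hs => ?_⟩
      rw [perspective_of_pos _ _ one_pos, hℓ.generalizedSum_one, hℓ.generalizedSum_one]
      simp [mul_inv_cancel_left₀ hs.ne']
    · exact exists_perspective_le hψ (hℓ.generalizedSum_zero_pos h1) _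
  exact ⟨m, ⟨mem_primalValues hub hw hle hr hmin, hub⟩, hleast⟩

theorem IsIncreasingLoss.le_perspective (hℓ : IsIncreasingLoss ℓ)
    (hψ : ConvexOn ℝ Set.univ (generalizedSum ℓ n)) (v : Fin n → ℝ) (i : Fin n) (r : ℝ) :
    (v i : EReal) ≤ perspective (generalizedSum ℓ n) v r := by
  refine le_perspective_of_forall_pos hψ (fun s hs => ?_) r
  have h := mul_le_mul_of_nonneg_left (hℓ.le_generalizedSum (s⁻¹ • v) i) hs.le
  rwa [Pi.smul_apply, smul_eq_mul, mul_inv_cancel_left₀ hs.ne'] at h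

/-- Far to the left, a bounded shift of the argument absorbs any constant factor, since it
multiplies the exponential by a constant. -/
theorem HasExponentialTail.exists_mul_le (hℓ : IsIncreasingLoss ℓ) (ht : HasExponentialTail ℓ)
    (N : ℝ) (hN : 0 < N) : ∃ c z₀ : ℝ, ∀ z ≤ z₀, N * ℓ z ≤ ℓ (z + c) := by
  obtain ⟨a, ha, h1, h2⟩ := ht
  obtain ⟨C₁, hC₁, h1⟩ := h1.exists_pos
  obtain ⟨C₂, hC₂, h2⟩ := h2.exists_pos
  obtain ⟨z₁, h1⟩ := eventually_atBot.1 h1.bound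
  obtain ⟨z₂, h2⟩ := eventually_atBot.1 h2.bound
  -- The shift `c` only needs `exp(a c) ≥ N C₁ C₂`; the choice `a c = N C₁ C₂` suffices because `t ≤
  -- exp t`.
  refine ⟨N * C₁ * C₂ / a, min z₁ (z₂ - N * C₁ * C₂ / a), fun z hz => ?_⟩
  have h1 := h1 z (hz.trans (min_le_left _ _))
  have h2 := h2 (z + N * C₁ * C₂ / a) (by linarith [hz.trans (min_le_right _ _)])
  rw [Real.norm_of_nonneg (hℓ.pos _).le, Real.norm_of_nonneg (Real.exp_pos _).le] at h1 h2
  have e : a * (z + N * C₁ * C₂ / a) = N * C₁ * C₂ + a * z := by field_simp; ring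
  rw [e, Real.exp_add] at h2
  have h3 : N * C₁ * C₂ ≤ Real.exp (N * C₁ * C₂) := by linarith [Real.add_one_le_exp (N * C₁ * C₂)]
  have h4 : N * C₁ * C₂ * Real.exp (a * z) ≤ C₂ * ℓ (z + N * C₁ * C₂ / a) :=
    (mul_le_mul_of_nonneg_right h3 (Real.exp_pos _).le).trans h2
  refine le_of_mul_le_mul_left ?_ hC₂
  calc C₂ * (N * ℓ z) ≤ C₂ * (N * (C₁ * Real.exp (a * z))) := by gcongr
    _ = N * C₁ * C₂ * Real.exp (a * z) := by ring
    _ ≤ _ := h4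

/-- As `s ↓ 0`, the entries of `v / s` are at most `M / s → -∞`, so summing `n` losses costs only a
fixed shift `c`: `s ψ(v/s) ≤ M + s c → M`. -/
theorem HasExponentialTail.perspective_zero_le (hℓ : IsIncreasingLoss ℓ)
    (ht : HasExponentialTail ℓ) (hn : 0 < n) (hψ : ConvexOn ℝ Set.univ (generalizedSum ℓ n))
    {v : Fin n → ℝ} {M : ℝ} (hM : M < 0) (hv : ∀ i, v i ≤ M) :
    perspective (generalizedSum ℓ n) v 0 ≤ (M : EReal) := by
  obtain ⟨c, z₀, hc⟩ := ht.exists_mul_le hℓ n (by exact_mod_cast hn)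
  have hlim : Tendsto (fun s : ℝ => ((M + s * c : ℝ) : EReal)) (𝓝[>] 0) (𝓝 (M : EReal)) := by
    refine (continuous_coe_real_ereal.tendsto _).comp (Tendsto.mono_left ?_ nhdsWithin_le_nhds)
    exact (continuous_const.add (continuous_id.mul continuous_const)).tendsto' 0 _ (by simp)
  have hbot : ∀ᶠ s : ℝ in 𝓝[>] 0, s⁻¹ * M ≤ z₀ :=
    (tendsto_inv_nhdsGT_zero.atTop_mul_const_of_neg hM).eventually_le_atBot z₀
  refine le_of_tendsto_of_tendsto (perspective_tendsto hψ v) hlim ?_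
  filter_upwards [hbot, self_mem_nhdsWithin] with s hs hs0
  have hs0 : 0 < s := hs0
  rw [EReal.coe_le_coe_iff]
  have h : generalizedSum ℓ n (s⁻¹ • v) ≤ s⁻¹ * M + c := by
    rw [← hℓ.strictMono.le_iff_le, hℓ.apply_generalizedSum hn]
    refine le_trans ?_ (hc _ hs)
    calc ∑ i, ℓ ((s⁻¹ • v) i) ≤ ∑ _i : Fin n, ℓ (s⁻¹ * M) := by
          refine Finset.sum_le_sum fun i _ => hℓ.strictMono.monotone ?_
          exact mul_le_mul_of_nonneg_left (hv i) (inv_pos.2 hs0).le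
      _ = n * ℓ (s⁻¹ * M) := by simp
  calc s * generalizedSum ℓ n (s⁻¹ • v) ≤ s * (s⁻¹ * M + c) := by gcongr
    _ = M + s * c := by field_simp

end Loss

/-! ### Maximum margin as the primal value. -/

section Margin

variable {n d : ℕ}

theorem dataMatrix_mulVec (x : Fin n → EuclideanSpace ℝ (Fin d)) (y : Fin n → ℝ)
    (w : EuclideanSpace ℝ (Fin d)) (i : Fin n) :
    (dataMatrix x y *ᵥ w.ofLp) i = -(y i * inner ℝ w (x i)) := by
  rw [EuclideanSpace.inner_eq_star_dotProduct, star_trivial]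
  simp only [mulVec, dataMatrix, dotProduct, Matrix.of_apply, Finset.mul_sum,
    ← Finset.sum_neg_distrib]
  exact Finset.sum_congr rfl fun j _ => by ring

/-- For separable data the maximum margin exists and is positive. -/
theorem exists_isGreatest_unitMargins (hn : 0 < n) (x : Fin n → EuclideanSpace ℝ (Fin d))
    (y : Fin n → ℝ) (hu : ∃ u : EuclideanSpace ℝ (Fin d), ∀ i, 0 < y i * inner ℝ u (x i)) :
    ∃ γ : ℝ, 0 < γ ∧ IsGreatest (unitMargins x y) γ := by
  have : Nonempty (Fin n) := ⟨⟨0, hn⟩⟩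
  obtain ⟨u, hu⟩ := hu
  have hu0 : u ≠ 0 := by
    rintro rfl
    simpa using hu ⟨0, hn⟩
  have hmem : ‖u‖⁻¹ • u ∈ Metric.sphere (0 : EuclideanSpace ℝ (Fin d)) 1 := by
    simp [norm_smul, inv_mul_cancel₀ (norm_ne_zero_iff.2 hu0)]
  have hcont : Continuous fun u : EuclideanSpace ℝ (Fin d) => ⨅ i, y i * inner ℝ u (x i) := by
    simp only [← Finset.inf'_univ_eq_ciInf]
    exact Continuous.finset_inf'_apply _ fun i _ => by fun_prop
  obtain ⟨v, hv, hmax⟩ := (isCompact_sphere (0 : EuclideanSpace ℝ (Fin d)) 1).exists_isMaxOn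
    ⟨_, hmem⟩ hcont.continuousOn
  refine ⟨⨅ i, y i * inner ℝ v (x i), lt_of_lt_of_le ?_ (hmax hmem), ⟨v, by simpa using hv, rfl⟩, ?_⟩
  · obtain ⟨i, hi⟩ := exists_eq_ciInf_of_finite (f := fun i => y i * inner ℝ (‖u‖⁻¹ • u) (x i))
    simp only [← hi]
    rw [real_inner_smul_left, mul_left_comm]
    exact mul_pos (inv_pos.2 (norm_pos_iff.2 hu0)) (hu i)
  · rintro _ ⟨w, hw, rfl⟩
    exact hmax (by simpa using hw)

/-- Normalizing `w` gives a margin at most `‖w‖ γ`, and positivity of `γ` lets the unit sphere bound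
pass to the ball. -/
theorem exists_margin_le (hn : 0 < n) {x : Fin n → EuclideanSpace ℝ (Fin d)} {y : Fin n → ℝ}
    {γ : ℝ} (hγ0 : 0 < γ) (hγ : γ ∈ upperBounds (unitMargins x y))
    {w : EuclideanSpace ℝ (Fin d)} (hw : ‖w‖ ≤ 1) : ∃ i, y i * inner ℝ w (x i) ≤ γ := by
  have : Nonempty (Fin n) := ⟨⟨0, hn⟩⟩
  rcases eq_or_ne w 0 with rfl | hw0
  · exact ⟨⟨0, hn⟩, by simpa using hγ0.le⟩
  · have hpos := norm_pos_iff.2 hw0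
    have h : (⨅ i, y i * inner ℝ (‖w‖⁻¹ • w) (x i)) ≤ γ :=
      hγ ⟨‖w‖⁻¹ • w, by simp [norm_smul, inv_mul_cancel₀ hpos.ne'], rfl⟩
    obtain ⟨i, hi⟩ := exists_eq_ciInf_of_finite (f := fun i => y i * inner ℝ (‖w‖⁻¹ • w) (x i))
    simp only [← hi] at h
    rw [real_inner_smul_left, mul_left_comm, inv_mul_le_iff₀ hpos] at h
    exact ⟨i, h.trans (mul_le_of_le_one_left hγ0.le hw)⟩

theorem isGreatest_primalValues_margin {ℓ : ℝ → ℝ} (hℓ : IsIncreasingLoss ℓ)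
    (ht : HasExponentialTail ℓ) (hn : 0 < n) (hψ : ConvexOn ℝ Set.univ (generalizedSum ℓ n))
    {x : Fin n → EuclideanSpace ℝ (Fin d)} {y : Fin n → ℝ} {γ : ℝ} (hγ0 : 0 < γ)
    (hγ : IsGreatest (unitMargins x y) γ) :
    IsGreatest (primalValues (dataMatrix x y) (generalizedSum ℓ n)) (γ : EReal) := by
  have hub : (γ : EReal) ∈ upperBounds (primalValues (dataMatrix x y) (generalizedSum ℓ n)) := by
    rintro _ ⟨w, r, hw, -, rfl⟩
    obtain ⟨i, hi⟩ := exists_margin_le hn hγ0 hγ.2 hw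
    rw [EReal.neg_le, ← EReal.coe_neg]
    refine le_trans ?_ (hℓ.le_perspective hψ _ i r)
    rw [dataMatrix_mulVec, EReal.coe_le_coe_iff]
    exact neg_le_neg hi
  obtain ⟨u, hu, hγu⟩ := hγ.1
  refine ⟨⟨u, 0, hu.le, le_rfl, le_antisymm ?_ (hub ⟨u, 0, hu.le, le_rfl, rfl⟩)⟩, hub⟩
  rw [EReal.le_neg, ← EReal.coe_neg]
  refine ht.perspective_zero_le hℓ hn hψ (neg_lt_zero.2 hγ0) fun i => ?_
  rw [dataMatrix_mulVec, neg_le_neg_iff, hγu]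
  exact ciInf_le (Set.finite_range _).bddBelow i

end Margin

/-! ### The exponential and logistic losses. -/

section Examples

/-- After subtracting the log-sums `P` and `Q`, the exponentials at each endpoint sum to `1`;
termwise convexity of `exp` then keeps the sum at most `1` in between. -/
theorem convexOn_log_sum_exp {E ι : Type*} [AddCommGroup E] [Module ℝ E] {s : Finset ι}
    (hs : s.Nonempty) (L : ι → E →ₗ[ℝ] ℝ) :
    ConvexOn ℝ Set.univ fun ξ => Real.log (∑ j ∈ s, Real.exp (L j ξ)) := by
  refine ⟨convex_univ, fun p _ q _ a b ha hb hab => ?_⟩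
  have hpos : ∀ ξ, 0 < ∑ j ∈ s, Real.exp (L j ξ) := fun ξ =>
    Finset.sum_pos (fun j _ => Real.exp_pos _) hs
  have hone : ∀ ξ, ∑ j ∈ s, Real.exp (L j ξ - Real.log (∑ j ∈ s, Real.exp (L j ξ))) = 1 := by
    intro ξ
    simp only [Real.exp_sub, Real.exp_log (hpos ξ), ← Finset.sum_div]
    exact div_self (hpos ξ).ne'
  simp only [smul_eq_mul]
  set P := Real.log (∑ j ∈ s, Real.exp (L j p)) with hP
  set Q := Real.log (∑ j ∈ s, Real.exp (L j q)) with hQ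
  rw [Real.log_le_iff_le_exp (hpos _)]
  have hsum : ∑ j ∈ s, Real.exp (a * (L j p - P) + b * (L j q - Q)) ≤ 1 := by
    calc ∑ j ∈ s, Real.exp (a * (L j p - P) + b * (L j q - Q))
        ≤ ∑ j ∈ s, (a * Real.exp (L j p - P) + b * Real.exp (L j q - Q)) :=
          Finset.sum_le_sum fun j _ =>
            convexOn_exp.2 (Set.mem_univ _) (Set.mem_univ _) ha hb hab
      _ = 1 := by rw [Finset.sum_add_distrib, ← Finset.mul_sum, ← Finset.mul_sum, hone, hone,
            mul_one, mul_one, hab]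
  calc ∑ j ∈ s, Real.exp (L j (a • p + b • q))
      = Real.exp (a * P + b * Q) * ∑ j ∈ s, Real.exp (a * (L j p - P) + b * (L j q - Q)) := by
        rw [Finset.mul_sum]
        refine Finset.sum_congr rfl fun j _ => ?_
        rw [← Real.exp_add, map_add, map_smul, map_smul, smul_eq_mul, smul_eq_mul]
        congr 1
        ring
    _ ≤ Real.exp (a * P + b * Q) := mul_le_of_le_one_right (Real.exp_pos _).le hsum

theorem isIncreasingLoss_expLoss : IsIncreasingLoss expLoss :=
  ⟨Real.exp_strictMono, Real.range_exp⟩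

theorem hasExponentialTail_expLoss : HasExponentialTail expLoss := by
  refine ⟨1, one_pos, ?_⟩
  simp only [one_mul]
  exact Asymptotics.isTheta_refl _ _

theorem convexOn_generalizedSum_expLoss {n : ℕ} (hn : 0 < n) :
    ConvexOn ℝ Set.univ (generalizedSum expLoss n) := by
  have : Nonempty (Fin n) := ⟨⟨0, hn⟩⟩
  refine (convexOn_log_sum_exp Finset.univ_nonempty
    fun i : Fin n => (LinearMap.proj i : (Fin n → ℝ) →ₗ[ℝ] ℝ)).congr fun ξ _ => ?_
  have h := isIncreasingLoss_expLoss.apply_generalizedSum hn ξ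
  simp only [expLoss] at h
  simp only [LinearMap.proj_apply]
  rw [← h, Real.log_exp]

theorem isIncreasingLoss_logisticLoss : IsIncreasingLoss logisticLoss := by
  refine ⟨fun a b hab => Real.log_lt_log (by positivity) (by simpa using hab), ?_⟩
  ext t
  refine ⟨?_, fun ht => ?_⟩
  · rintro ⟨z, rfl⟩
    exact Real.log_pos (by linarith [Real.exp_pos z])
  · have ht : 1 < Real.exp t := Real.one_lt_exp_iff.2 ht
    refine ⟨Real.log (Real.exp t - 1), ?_⟩
    rw [logisticLoss, Real.exp_log (by linarith), add_sub_cancel, Real.log_exp]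

theorem hasExponentialTail_logisticLoss : HasExponentialTail logisticLoss := by
  refine ⟨1, one_pos, ?_, ?_⟩ <;> simp only [one_mul]
  · refine Asymptotics.IsBigO.of_bound 1 (Eventually.of_forall fun z => ?_)
    rw [Real.norm_of_nonneg (isIncreasingLoss_logisticLoss.pos z).le,
      Real.norm_of_nonneg (Real.exp_pos z).le, one_mul, logisticLoss]
    linarith [Real.log_le_sub_one_of_pos (show 0 < 1 + Real.exp z by positivity)]
  · refine Asymptotics.IsBigO.of_bound 2 ?_
    filter_upwards [eventually_le_atBot 0] with z hz
    rw [Real.norm_of_nonneg (isIncreasingLoss_logisticLoss.pos z).le,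
      Real.norm_of_nonneg (Real.exp_pos z).le, logisticLoss]
    have hpos := Real.exp_pos z
    have h1 : Real.exp z ≤ 1 := Real.exp_le_one_iff.2 hz
    -- With `x = exp z ≤ 1`: `log(1 + x) ≥ x/(1 + x) ≥ x/2`, whence the constant `2`.
    have h2 := Real.one_sub_inv_le_log_of_pos (show 0 < 1 + Real.exp z by positivity)
    have h3 : Real.exp z / 2 ≤ 1 - (1 + Real.exp z)⁻¹ := by
      have e : 1 - (1 + Real.exp z)⁻¹ = Real.exp z / (1 + Real.exp z) := by field_simp; ring
      rw [e]
      gcongr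
      linarith
    linarith

/-- Expanding `1 + exp ψ = ∏ (1 + exp ξᵢ)` over subsets shows that `ψ` is the log-sum-exp of the
forms `∑_{i ∈ S} ξᵢ` over nonempty `S`. -/
theorem convexOn_generalizedSum_logisticLoss {n : ℕ} (hn : 0 < n) :
    ConvexOn ℝ Set.univ (generalizedSum logisticLoss n) := by
  have hne : ((Finset.univ : Finset (Fin n)).powerset.erase ∅).Nonempty :=
    ⟨{⟨0, hn⟩}, by simp⟩
  refine (convexOn_log_sum_exp hne
    fun S => (∑ i ∈ S, LinearMap.proj i : (Fin n → ℝ) →ₗ[ℝ] ℝ)).congr fun ξ _ => ?_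
  have h := isIncreasingLoss_logisticLoss.apply_generalizedSum hn ξ
  simp only [logisticLoss] at h
  rw [← Real.log_prod (fun i _ => by positivity)] at h
  have h2 := Real.log_injOn_pos (Set.mem_Ioi.2 (by positivity))
    (Set.mem_Ioi.2 (Finset.prod_pos fun i _ => by positivity)) h
  rw [Finset.prod_one_add, ← Finset.add_sum_erase _ _ (Finset.empty_mem_powerset _),
    Finset.prod_empty, add_right_inj] at h2
  simp only [LinearMap.sum_apply, LinearMap.proj_apply, Real.exp_sum]
  rw [← h2, Real.log_exp]

end Examples

theorem mainTheorem8 :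
    -- smoothed margin of a loss: the maximum and the minimum exist and are equal
    (∀ (n d : ℕ) (Z : Matrix (Fin n) (Fin d) ℝ) (ℓ : ℝ → ℝ),
      0 < n → IsIncreasingLoss ℓ → ConvexOn ℝ Set.univ (generalizedSum ℓ n) →
      ∃ m : ℝ, IsGreatest (primalValues Z (generalizedSum ℓ n)) (m : EReal) ∧
        IsLeast (dualValues Z (generalizedSum ℓ n)) m) ∧
    -- arbitrary finite convex function: the same with a supremum, attained if `ψ 0 ≠ 0`
    (∀ (n d : ℕ) (Z : Matrix (Fin n) (Fin d) ℝ) (ψ : (Fin n → ℝ) → ℝ),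
      ConvexOn ℝ Set.univ ψ →
      (∃ B : ℝ, ∀ w : EuclideanSpace ℝ (Fin d), ‖w‖ ≤ 1 → ∀ r : ℝ,
        (B : EReal) ≤ perspective ψ (Z *ᵥ w.ofLp) r) →
      ∃ m : ℝ, IsLUB (primalValues Z ψ) (m : EReal) ∧ IsLeast (dualValues Z ψ) m ∧
        (ψ 0 ≠ 0 → (m : EReal) ∈ primalValues Z ψ)) ∧
    -- exponentially-tailed losses, separable data: the common value is the maximum margin
    (∀ (n d : ℕ) (x : Fin n → EuclideanSpace ℝ (Fin d)) (y : Fin n → ℝ) (ℓ : ℝ → ℝ),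
      0 < n → (∀ i, y i = 1 ∨ y i = -1) →
      (∃ u : EuclideanSpace ℝ (Fin d), ∀ i, 0 < y i * inner ℝ u (x i)) →
      IsIncreasingLoss ℓ → HasExponentialTail ℓ → ConvexOn ℝ Set.univ (generalizedSum ℓ n) →
      ∃ γ : ℝ, 0 < γ ∧ IsGreatest (unitMargins x y) γ ∧
        IsGreatest (primalValues (dataMatrix x y) (generalizedSum ℓ n)) (γ : EReal) ∧
        IsLeast (dualValues (dataMatrix x y) (generalizedSum ℓ n)) γ) ∧
    -- the exponential and the logistic loss satisfy all these hypotheses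
    (∀ ℓ : ℝ → ℝ, ℓ = expLoss ∨ ℓ = logisticLoss →
      IsIncreasingLoss ℓ ∧ HasExponentialTail ℓ ∧
        ∀ n : ℕ, 0 < n → ConvexOn ℝ Set.univ (generalizedSum ℓ n)) := by
  refine ⟨fun n d Z ℓ hn hℓ hψ => hℓ.primal_dual hn hψ Z,
    fun n d Z ψ hψ hB => primal_dual_of_bounded hψ Z hB, ?_, ?_⟩
  · intro n d x y ℓ hn _ hu hℓ ht hψ
    obtain ⟨γ, hγ0, hγ⟩ := exists_isGreatest_unitMargins hn x y hu
    have hg := isGreatest_primalValues_margin hℓ ht hn hψ hγ0 hγ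
    obtain ⟨m, hm, hleast⟩ := hℓ.primal_dual hn hψ (dataMatrix x y)
    obtain rfl : m = γ := EReal.coe_eq_coe_iff.1 (hm.unique hg)
    exact ⟨m, hγ0, hγ, hg, hleast⟩
  · rintro ℓ (rfl | rfl)
    · exact ⟨isIncreasingLoss_expLoss, hasExponentialTail_expLoss,
        fun n hn => convexOn_generalizedSum_expLoss hn⟩
    · exact ⟨isIncreasingLoss_logisticLoss, hasExponentialTail_logisticLoss,
        fun n hn => convexOn_generalizedSum_logisticLoss hn⟩
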